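/- Let $\Omega\subset\mathbb R^n$ be open and let $\boldsymbol F\in\mathcal{DM}^{\mathrm{ext}}(\Omega)$, that is, $\boldsymbol F$ is a finite $\mathbb R^n$-valued Radon measure on $\Omega$ with $$\sup\Big\{\int_\Omega\nabla\varphi\cdot d\boldsymbol F:\ \varphi\in C^1_c(\Omega),\ |\varphi|\le1\Big\}<\infty,$$ so that its distributional divergence $\operatorname{div}\boldsymbol F$, given by $\int_\Omega\varphi\,d(\operatorname{div}\boldsymbol F)=-\int_\Omega\nabla\varphi\cdot d\boldsymbol F$ for $\varphi\in C_c^\infty(\Omega)$, is a finite signed Radon measure on $\Omega$. For a Borel set $E\Subset\Omega$ (i.e. $\overline E$ is compact and $\overline E\subset\Omega$) the normal trace of $\boldsymbol F$ on $\partial E$ is the distribution $$\langle\boldsymbol F\cdot\nu,\phi\rangle_{\partial E}=-\int_E\nabla\phi\cdot d\boldsymbol F-\int_E\phi\,d(\operatorname{div}\boldsymbol F)\qquad(\phi\in C^1_c(\Omega)),$$ extended to $\phi\in W^{1,\infty}(\Omega)$ (continuous representative) by $\langle\boldsymbol F\cdot\nu,\phi\rangle_{\partial E}=-\operatorname{div}(\phi\boldsymbol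 F)(E)$. If the distribution $\langle\boldsymbol F\cdot\nu,\cdot\rangle_{\partial E}$ in $\Omega$ is represented by a finite signed Radon measure on $\Omega$, this measure is denoted by $(\boldsymbol F\cdot\nu)_{\partial E}$. Let $U,V\Subset\Omega$ be Borel sets (for instance, open sets) and let $A\subset\mathbb R^n$ be an open set with $U\cap A=V\cap A$. Then: 1. $A\cap\partial U=A\cap\partial V$. 2. For every $\phi\in W^{1,\infty}_c(A)$ (functions in $W^{1,\infty}(A)$ with compact support in $A$, extended by zero), $\phi\boldsymbol F\in\mathcal{DM}^{\mathrm{ext}}(\Omega)$, so that the normal traces tested against $\phi$ are defined, and $$\langle\boldsymbol F\cdot\nu,\phi\rangle_{\partial U}=\langle\boldsymbol F\cdot\nu,\phi\rangle_{\partial V}.$$ 3. In particular, if the normal traces of $\boldsymbol F$ on $\partial U$ and on $\partial V$ are both represented by measures, then, with $\mu\llcorner S$ denoting the restriction $B\mapsto\mu(B\cap S)$ of a measure $\mu$ to a set $S$, $$(\boldsymbol F\cdot\nu)_{\partial U}\llcorner(\partial U\cap A)=(\boldsymbol F\cdot\nu)_{\partial V}\llcorner(\partial V\cap A).$$ -/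

import Mathlib

open MeasureTheory Set TopologicalSpace
open scoped Distributions

noncomputable section

namespace NormalTrace

/-- `E ⋐ Ω`: the closure of `E` is compact and contained in `Ω`. -/
def CompactlyContained {n : ℕ} (E : Set (EuclideanSpace ℝ (Fin n)))
    (Ω : Opens (EuclideanSpace ℝ (Fin n))) : Prop :=
  IsCompact (closure E) ∧ closure E ⊆ Ω

/-- Finite signed Radon measures on the open set `Ω ⊆ ℝⁿ`, i.e. countably additive real-valued set
functions on the Borel subsets of `Ω` (regularity is automatic). -/
abbrev ScalarMeasure {n : ℕ} (Ω : Opens (EuclideanSpace ℝ (Fin n))) : Type :=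
  SignedMeasure Ω

/-- Finite `ℝⁿ`-valued Radon measures on the open set `Ω ⊆ ℝⁿ`. -/
abbrev FieldMeasure {n : ℕ} (Ω : Opens (EuclideanSpace ℝ (Fin n))) : Type :=
  VectorMeasure Ω (EuclideanSpace ℝ (Fin n))

/-- The integral `∫_S ∇φ · dF` over the part of `S` inside `Ω`. The gradient enters through the
derivative `fderiv ℝ φ x : ℝⁿ →L[ℝ] ℝ`, which is paired with the vector-valued measure `F` by
evaluation. -/
def gradIntegral {n : ℕ} {Ω : Opens (EuclideanSpace ℝ (Fin n))} (F : FieldMeasure Ω)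
    (S : Set (EuclideanSpace ℝ (Fin n))) (φ : EuclideanSpace ℝ (Fin n) → ℝ) : ℝ :=
  (F.restrict ((↑) ⁻¹' S)).integral (fun x : Ω => fderiv ℝ φ x)
    (ContinuousLinearMap.id ℝ (EuclideanSpace ℝ (Fin n) →L[ℝ] ℝ))

/-- The integral `∫_S φ dσ` over the part of `S` inside `Ω`. -/
def scalarIntegral {n : ℕ} {Ω : Opens (EuclideanSpace ℝ (Fin n))} (σ : ScalarMeasure Ω)
    (S : Set (EuclideanSpace ℝ (Fin n))) (φ : EuclideanSpace ℝ (Fin n) → ℝ) : ℝ :=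
  (σ.restrict ((↑) ⁻¹' S)).integral (fun x : Ω => φ x) (ContinuousLinearMap.lsmul ℝ ℝ)

/-- `F ∈ DM^ext(Ω)`: the `ℝⁿ`-valued finite Radon measure `F` on `Ω` satisfies
`sup {∫_Ω ∇φ · dF : φ ∈ C¹_c(Ω), |φ| ≤ 1} < ∞`. -/
def IsDivergenceMeasureField {n : ℕ} {Ω : Opens (EuclideanSpace ℝ (Fin n))}
    (F : FieldMeasure Ω) : Prop :=
  BddAbove {r : ℝ | ∃ φ : 𝓓^{1}(Ω, ℝ), (∀ x, |φ x| ≤ 1) ∧ r = gradIntegral F Ω φ}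

/-- `σ` is the distributional divergence of `F` in `Ω`:
`∫_Ω φ dσ = - ∫_Ω ∇φ · dF` for every `φ ∈ C^∞_c(Ω)`. -/
def HasDivergence {n : ℕ} {Ω : Opens (EuclideanSpace ℝ (Fin n))}
    (F : FieldMeasure Ω) (σ : ScalarMeasure Ω) : Prop :=
  ∀ φ : 𝓓(Ω, ℝ), scalarIntegral σ Ω φ = - gradIntegral F Ω φ

open scoped Classical in
/-- The measure `div F` on `Ω`. There is at most one finite signed measure that is the distributional
divergence of `F`, and there is one if and only if `F ∈ DM^ext(Ω)`, by the Riesz representation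
theorem. Outside of `DM^ext(Ω)` the value is the junk value `0`. -/
def divergence {n : ℕ} {Ω : Opens (EuclideanSpace ℝ (Fin n))}
    (F : FieldMeasure Ω) : ScalarMeasure Ω :=
  if h : ∃ σ : ScalarMeasure Ω, HasDivergence F σ then h.choose else 0

/-- The field `φ F`, the `ℝⁿ`-valued measure with density `φ` with respect to `F`. -/
def mulField {n : ℕ} {Ω : Opens (EuclideanSpace ℝ (Fin n))}
    (φ : EuclideanSpace ℝ (Fin n) → ℝ) (F : FieldMeasure Ω) : FieldMeasure Ω :=
  F.withDensity (fun x : Ω => φ x) (ContinuousLinearMap.lsmul ℝ ℝ)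

/-- The normal trace of `F` on the boundary of `E ⋐ Ω`, as a distribution in `Ω`:
`⟨F · ν, φ⟩_{∂E} = - ∫_E ∇φ · dF - ∫_E φ d(div F)` for continuously differentiable `φ` with
compact support in `Ω`. -/
def normalTraceDistribution {n : ℕ} {Ω : Opens (EuclideanSpace ℝ (Fin n))}
    (F : FieldMeasure Ω) (E : Set (EuclideanSpace ℝ (Fin n)))
    (φ : EuclideanSpace ℝ (Fin n) → ℝ) : ℝ :=
  - gradIntegral F E φ - scalarIntegral (divergence F) E φ

/-- The extension of the normal trace to test functions `φ ∈ W^{1,∞}(Ω)`: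
`⟨F · ν, φ⟩_{∂E} = - div(φ F)(E)`. -/
def normalTrace {n : ℕ} {Ω : Opens (EuclideanSpace ℝ (Fin n))}
    (F : FieldMeasure Ω) (E : Set (EuclideanSpace ℝ (Fin n)))
    (φ : EuclideanSpace ℝ (Fin n) → ℝ) : ℝ :=
  - divergence (mulField φ F) ((↑) ⁻¹' E)

/-- The normal trace of `F` on the boundary of `E`, as a distribution in `Ω`, is represented by the
measure `m`; that is, `m = (F · ν)_{∂E}`. -/
def IsNormalTraceMeasure {n : ℕ} {Ω : Opens (EuclideanSpace ℝ (Fin n))}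
    (F : FieldMeasure Ω) (E : Set (EuclideanSpace ℝ (Fin n))) (m : ScalarMeasure Ω) : Prop :=
  ∀ φ : 𝓓(Ω, ℝ), normalTraceDistribution F E φ = scalarIntegral m Ω φ

/-- `φ ∈ W^{1,∞}(A)`: `φ` is essentially bounded on `A` and has an essentially bounded weak gradient
there. Every such function has a (unique, locally Lipschitz) continuous representative on `A`, and
`φ` is taken to be this representative. Values of `φ` outside `A` play no role. -/
def MemW1Infty {n : ℕ} (A : Opens (EuclideanSpace ℝ (Fin n)))
    (φ : EuclideanSpace ℝ (Fin n) → ℝ) : Prop :=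
  ContinuousOn φ A ∧ MemLp φ ⊤ (volume.restrict A) ∧
    ∃ g : EuclideanSpace ℝ (Fin n) → (EuclideanSpace ℝ (Fin n) →L[ℝ] ℝ),
      MemLp g ⊤ (volume.restrict A) ∧
        ∀ ψ : 𝓓(A, ℝ), ∫ x in A, φ x • fderiv ℝ ψ x = - ∫ x in A, ψ x • g x

/-- `φ ∈ W^{1,∞}_c(A)`, extended by zero to all of `ℝⁿ`. -/
def MemW1InftyCompact {n : ℕ} (A : Opens (EuclideanSpace ℝ (Fin n)))
    (φ : EuclideanSpace ℝ (Fin n) → ℝ) : Prop :=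
  MemW1Infty A φ ∧ HasCompactSupport φ ∧ tsupport φ ⊆ A

end NormalTrace

end

/-! All three claims hold because the boundary, the divergence and the trace depend, inside the open
set `A`, only on the part of the set lying in `A`. For boundaries this is the locality of closures,
applied to the set and to its complement.

For the second claim, `div(φF)` is a measure concentrated on the support of `φ`, and on that support
`U` and `V` coincide. This requires `φF` to lie in `DM^ext(Ω)`. Let `u` be a mollification of `φ`;
the product rule `u∇ψ = ∇(uψ) - ψ∇u` bounds the integral of `u∇ψ` by the bound for `F` on `uψ` plus
the sup of `|∇u|` times the total variation of `F`. Both bounds are uniform in the mollification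
parameter, and dominated convergence passes to `φ` (`IsDivergenceMeasureField.mulField`). It also
requires the divergence to exist as a measure: Hahn-Banach extends the functional from test
functions to `C_c`, and Riesz is applied to its positive and negative parts
(`exists_signedMeasure_of_abs_le`).

For the third claim, the two trace distributions agree on test functions supported in `A`, so the
difference of the representing measures vanishes on subsets of `A`
(`apply_eq_zero_of_scalarIntegral_eq_zero`, through the Hahn decomposition). -/

namespace NormalTrace

/-! ### Integration against vector measures of finite variation -/

section VectorMeasure

variable {X : Type*} {mX : MeasurableSpace X}

instance isFiniteMeasure_variation_signedMeasure (σ : SignedMeasure X) :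
    IsFiniteMeasure σ.variation := by
  rw [← σ.totalVariation_eq_variation]
  unfold SignedMeasure.totalVariation
  infer_instance

theorem enorm_le_sum_enorm_apply {n : ℕ} (v : EuclideanSpace ℝ (Fin n)) :
    ‖v‖ₑ ≤ ∑ i, ‖v i‖ₑ := by
  have h : ‖v‖ ≤ ∑ i, ‖v i‖ := by
    conv_lhs => rw [← (EuclideanSpace.basisFun (Fin n) ℝ).sum_repr v]
    refine (norm_sum_le _ _).trans (le_of_eq ?_)
    simp [norm_smul]
  have h' : ‖v‖₊ ≤ ∑ i, ‖v i‖₊ := by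
    rw [← NNReal.coe_le_coe]
    simpa using h
  simp only [enorm_eq_nnnorm]
  exact_mod_cast h'

/-- The coordinates of the measure are signed measures, hence of finite variation, and the Euclidean
norm is at most the sum of the absolute coordinates. Finiteness makes every bounded measurable
integrand integrable. -/
instance isFiniteMeasure_variation_euclidean {n : ℕ}
    (μ : VectorMeasure X (EuclideanSpace ℝ (Fin n))) : IsFiniteMeasure μ.variation := by
  let p : Fin n → SignedMeasure X := fun i =>
    μ.mapRange (EuclideanSpace.proj i : EuclideanSpace ℝ (Fin n) →L[ℝ] ℝ).toLinearMap.toAddMonoidHom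
      (EuclideanSpace.proj i : EuclideanSpace ℝ (Fin n) →L[ℝ] ℝ).continuous
  have h : μ.variation ≤ ∑ i, (p i).variation := by
    refine VectorMeasure.variation_le_of_forall_enorm_le fun s _ => ?_
    refine (enorm_le_sum_enorm_apply _).trans ?_
    rw [Measure.finsetSum_apply]
    refine Finset.sum_le_sum fun i _ => ?_
    exact (p i).enorm_measure_le_variation s
  exact isFiniteMeasure_of_le _ h

variable {E F G : Type*} [NormedAddCommGroup E] [NormedSpace ℝ E]
  [NormedAddCommGroup F] [NormedSpace ℝ F] [NormedAddCommGroup G] [NormedSpace ℝ G]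

/-- Integration of a bounded function against a vector measure with bounded scalar density. -/
theorem integral_withDensity_lsmul [CompleteSpace F] [CompleteSpace G]
    (μ : VectorMeasure X F) [IsFiniteMeasure μ.variation] {φ : X → ℝ} (hφ : Measurable φ) {C : ℝ}
    (hC : ∀ x, ‖φ x‖ ≤ C) {g : X → E} (hg : StronglyMeasurable g) {D : ℝ} (hD : ∀ x, ‖g x‖ ≤ D)
    (B : E →L[ℝ] F →L[ℝ] G) :
    (μ.withDensity φ (ContinuousLinearMap.lsmul ℝ ℝ)).integral g B =
      μ.integral (fun x => φ x • g x) B := by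
  have hφi : μ.Integrable φ := .of_bound hφ.aestronglyMeasurable C (.of_forall hC)
  -- Finite variation of the weighted measure is what permits dominated convergence on the left-hand
  -- side.
  have hle : (μ.withDensity φ (ContinuousLinearMap.lsmul ℝ ℝ)).variation ≤
      C.toNNReal • μ.variation := by
    refine VectorMeasure.variation_WithDensity_le.trans ?_
    rw [VectorMeasure.variation_transpose_lsmul]
    calc μ.variation.withDensity (fun x => ‖φ x‖ₑ)
        ≤ μ.variation.withDensity (fun _ => (C.toNNReal : ENNReal)) := by
          refine withDensity_mono (.of_forall fun x => ?_)
          change ‖φ x‖ₑ ≤ (C.toNNReal : ENNReal)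
          rw [← ofReal_norm]
          exact ENNReal.ofReal_le_ofReal (hC x)
      _ = C.toNNReal • μ.variation := by
          rw [withDensity_const]; rfl
  have : IsFiniteMeasure (μ.withDensity φ (ContinuousLinearMap.lsmul ℝ ℝ)).variation :=
    isFiniteMeasure_of_le _ hle
  have key : ∀ f : SimpleFunc X E,
      (μ.withDensity φ (ContinuousLinearMap.lsmul ℝ ℝ)).integral f B =
        μ.integral (fun x => φ x • f x) B := by
    have hfi : ∀ f : SimpleFunc X E, μ.Integrable fun x => φ x • f x := fun f =>
      (f.integrable_of_isFiniteMeasure (μ := μ.variation)).bdd_smul C hφ.aestronglyMeasurable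
        (.of_forall hC)
    intro f
    induction f using SimpleFunc.induction with
    | const c hs =>
      rename_i s
      have h1 : ⇑(SimpleFunc.piecewise s hs (SimpleFunc.const X c) (SimpleFunc.const X 0)) =
          s.indicator fun _ => c := by
        ext x
        by_cases hx : x ∈ s <;> simp [hx]
      -- Writing `φ x • c` as a continuous linear map applied to `φ x` lets the constant `c` move
      -- out of the integral.
      have h2 : (fun x => φ x • s.indicator (fun _ => c) x) =
          s.indicator fun x => ContinuousLinearMap.toSpanSingleton ℝ c (φ x) := by
        ext x
        by_cases hx : x ∈ s <;> simp [hx]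
      rw [h1, h2, VectorMeasure.integral_indicator_const _ hs, VectorMeasure.integral_indicator hs,
        VectorMeasure.withDensity_apply hφi,
        VectorMeasure.continuousLinearMap_apply_integral hφi.restrict,
        VectorMeasure.integral_continuousLinearMap_comp hφi.restrict]
      congr 1
      ext x
      simp
    | add hfg ihf ihg =>
      rename_i f g
      simp only [SimpleFunc.coe_add, Pi.add_apply, smul_add]
      rw [VectorMeasure.integral_fun_add (hfi f) (hfi g), ← ihf, ← ihg]
      exact VectorMeasure.integral_add f.integrable_of_isFiniteMeasure
        g.integrable_of_isFiniteMeasure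
  have hb : ∀ n x, ‖hg.approxBounded D n x‖ ≤ D := fun n x =>
    hg.norm_approxBounded_le ((norm_nonneg _).trans (hD x)) n x
  have hl : ∀ x, Filter.Tendsto (fun n => hg.approxBounded D n x) Filter.atTop (nhds (g x)) :=
    fun x => hg.tendsto_approxBounded_of_norm_le (hD x)
  refine tendsto_nhds_unique (f := fun n =>
    (μ.withDensity φ (ContinuousLinearMap.lsmul ℝ ℝ)).integral (hg.approxBounded D n) B)
    (l := Filter.atTop) ?_ ?_
  · exact VectorMeasure.tendsto_integral_filter_of_norm_le_const
      (.of_forall fun n => (hg.approxBounded D n).stronglyMeasurable.aestronglyMeasurable)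
      ⟨D, .of_forall fun n => .of_forall (hb n)⟩ (.of_forall hl)
  · simp only [key]
    refine VectorMeasure.tendsto_integral_filter_of_norm_le_const
      (.of_forall fun n => hφ.aestronglyMeasurable.smul
        (hg.approxBounded D n).stronglyMeasurable.aestronglyMeasurable)
      ⟨C * D, .of_forall fun n => .of_forall fun x => ?_⟩
      (.of_forall fun x => (hl x).const_smul (φ x))
    rw [norm_smul]
    exact mul_le_mul (hC x) (hb n x) (norm_nonneg _) ((norm_nonneg _).trans (hC x))

/-- Integrals over two sets that agree on the support of the integrand agree. -/
theorem restrict_integral_congr_set {μ : VectorMeasure X F} {S T : Set X} (hS : MeasurableSet S)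
    (hT : MeasurableSet T) {g : X → E} (h : ∀ x, g x ≠ 0 → (x ∈ S ↔ x ∈ T))
    (B : E →L[ℝ] F →L[ℝ] G) :
    (μ.restrict S).integral g B = (μ.restrict T).integral g B := by
  rw [← VectorMeasure.integral_indicator hS, ← VectorMeasure.integral_indicator hT]
  congr 1
  ext x
  by_cases hx : g x = 0
  · simp [indicator, hx]
  · classical simp only [indicator, h x hx]

/-- The integral against a signed measure is the difference of the integrals against its positive
and negative parts. -/
theorem signedMeasure_integral_eq_sub (σ : SignedMeasure X) {g : X → ℝ}
    (hg : Integrable g σ.totalVariation) :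
    σ.integral g (ContinuousLinearMap.lsmul ℝ ℝ) =
      ∫ x, g x ∂σ.toJordanDecomposition.posPart - ∫ x, g x ∂σ.toJordanDecomposition.negPart := by
  obtain ⟨hp, hn⟩ := integrable_add_measure.1 hg
  -- Real multiplication commutes, so the pairing equals its flip, the form in which
  -- `VectorMeasure.integral_toSignedMeasure` is applied.
  have hflip : (ContinuousLinearMap.lsmul ℝ ℝ : ℝ →L[ℝ] ℝ →L[ℝ] ℝ) =
      (ContinuousLinearMap.lsmul ℝ ℝ : ℝ →L[ℝ] ℝ →L[ℝ] ℝ).flip := by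
    ext
    simp
  conv_lhs => rw [← SignedMeasure.toSignedMeasure_toJordanDecomposition σ,
    JordanDecomposition.toSignedMeasure, hflip]
  rw [VectorMeasure.integral_sub_vectorMeasure, VectorMeasure.integral_toSignedMeasure,
    VectorMeasure.integral_toSignedMeasure]
  · simpa [VectorMeasure.Integrable] using hp
  · simpa [VectorMeasure.Integrable] using hn

end VectorMeasure

end NormalTrace

noncomputable section

namespace NormalTrace

open scoped CompactlySupported NNReal
open CompactlySupportedContinuousMap

/-! ### Riesz representation for bounded signed functionals -/

section Riesz

variable {X : Type*} [TopologicalSpace X]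

/-- `Λ` is bounded by `M` with respect to the supremum norm. -/
def IsSupBounded (Λ : C_c(X, ℝ) →ₗ[ℝ] ℝ) (M : ℝ) : Prop :=
  ∀ (f : C_c(X, ℝ)) (C : ℝ), 0 ≤ C → (∀ x, |f x| ≤ C) → Λ f ≤ M * C

/-- The values of `Λ` on the functions between `0` and `f`. -/
def valuesBelow (Λ : C_c(X, ℝ) →ₗ[ℝ] ℝ) (f : C_c(X, ℝ≥0)) : Set ℝ :=
  (fun g : C_c(X, ℝ≥0) => Λ g.toReal) '' Iic f

/-- The positive part of the functional `Λ`, on nonnegative functions. -/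
def positivePart (Λ : C_c(X, ℝ) →ₗ[ℝ] ℝ) (f : C_c(X, ℝ≥0)) : ℝ :=
  sSup (valuesBelow Λ f)

theorem exists_le_const (f : C_c(X, ℝ≥0)) : ∃ C : ℝ, 0 ≤ C ∧ ∀ x, (f x : ℝ) ≤ C := by
  obtain ⟨C, hC⟩ :=
    (map_continuous f.toReal).bounded_above_of_compact_support f.toReal.hasCompactSupport
  refine ⟨max C 0, le_max_right _ _, fun x => ?_⟩
  have := hC x
  simp only [toReal_apply, Real.norm_eq_abs, NNReal.abs_eq] at this
  exact this.trans (le_max_left _ _)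

variable {Λ : C_c(X, ℝ) →ₗ[ℝ] ℝ} {M : ℝ}

theorem IsSupBounded.neg (h : IsSupBounded Λ M) : IsSupBounded (-Λ) M := by
  intro f C hC hf
  simpa using h (-f) C hC (by simpa using hf)

theorem IsSupBounded.le_of_mem_valuesBelow (h : IsSupBounded Λ M) {f : C_c(X, ℝ≥0)} {C : ℝ}
    (hC : 0 ≤ C) (hf : ∀ x, (f x : ℝ) ≤ C) {r : ℝ} (hr : r ∈ valuesBelow Λ f) : r ≤ M * C := by
  obtain ⟨g, hg, rfl⟩ := hr
  refine h _ C hC fun x => ?_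
  simp only [toReal_apply, NNReal.abs_eq]
  exact le_trans (by exact_mod_cast hg x) (hf x)

theorem IsSupBounded.bddAbove_valuesBelow (h : IsSupBounded Λ M) (f : C_c(X, ℝ≥0)) :
    BddAbove (valuesBelow Λ f) := by
  obtain ⟨C, hC, hf⟩ := exists_le_const f
  exact ⟨M * C, fun r hr => h.le_of_mem_valuesBelow hC hf hr⟩

theorem valuesBelow_nonempty (f : C_c(X, ℝ≥0)) : (valuesBelow Λ f).Nonempty :=
  ⟨_, 0, fun _ => zero_le, rfl⟩

theorem IsSupBounded.le_positivePart (h : IsSupBounded Λ M) {f g : C_c(X, ℝ≥0)} (hg : g ≤ f) :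
    Λ g.toReal ≤ positivePart Λ f :=
  le_csSup (h.bddAbove_valuesBelow f) ⟨g, hg, rfl⟩

theorem IsSupBounded.positivePart_nonneg (h : IsSupBounded Λ M) (f : C_c(X, ℝ≥0)) :
    0 ≤ positivePart Λ f := by
  have h0 : (0 : C_c(X, ℝ≥0)) ≤ f := fun x => zero_le
  have h1 : (0 : C_c(X, ℝ≥0)).toReal = 0 := by ext; simp
  simpa [h1] using h.le_positivePart h0

theorem positivePart_le {f : C_c(X, ℝ≥0)} {r : ℝ} (h : ∀ g ≤ f, Λ g.toReal ≤ r) :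
    positivePart Λ f ≤ r :=
  csSup_le (valuesBelow_nonempty f) (by rintro _ ⟨g, hg, rfl⟩; exact h g hg)

theorem IsSupBounded.positivePart_le_mul (h : IsSupBounded Λ M) {f : C_c(X, ℝ≥0)} {C : ℝ}
    (hC : 0 ≤ C) (hf : ∀ x, (f x : ℝ) ≤ C) : positivePart Λ f ≤ M * C :=
  csSup_le (valuesBelow_nonempty f) fun _ hr => h.le_of_mem_valuesBelow hC hf hr

/-- Riesz decomposition: any `0 ≤ g ≤ f₁ + f₂` splits as `g ⊓ f₁` plus a remainder that lies below
`f₂`. The reverse inequality adds competitors for the two suprema. -/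
theorem IsSupBounded.positivePart_add (h : IsSupBounded Λ M) (f₁ f₂ : C_c(X, ℝ≥0)) :
    positivePart Λ (f₁ + f₂) = positivePart Λ f₁ + positivePart Λ f₂ := by
  apply le_antisymm
  · refine positivePart_le fun g hg => ?_
    obtain ⟨g₂, hg₂⟩ := CompactlySupportedContinuousMap.exists_add_of_le
      (inf_le_left : g ⊓ f₁ ≤ g)
    have hle : g₂ ≤ f₂ := by
      intro x
      have h1 : min (g x) (f₁ x) + g₂ x = g x := DFunLike.congr_fun hg₂ x
      have h2 : g x ≤ f₁ x + f₂ x := hg x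
      rcases le_total (g x) (f₁ x) with h3 | h3
      · rw [min_eq_left h3] at h1
        have : g₂ x = 0 := by simpa using h1
        exact this.le.trans zero_le
      · rw [min_eq_right h3] at h1
        rw [← h1] at h2
        exact le_of_add_le_add_left h2
    rw [← hg₂, toReal_add, map_add]
    exact add_le_add (h.le_positivePart inf_le_right) (h.le_positivePart hle)
  · rw [← le_sub_iff_add_le]
    refine positivePart_le fun g₁ hg₁ => ?_
    rw [le_sub_comm]
    refine positivePart_le fun g₂ hg₂ => ?_
    rw [le_sub_iff_add_le, add_comm, ← map_add, ← toReal_add]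
    exact h.le_positivePart fun x => add_le_add (hg₁ x) (hg₂ x)

theorem IsSupBounded.positivePart_smul_le (h : IsSupBounded Λ M) {r : ℝ≥0} (hr : r ≠ 0)
    (f : C_c(X, ℝ≥0)) : positivePart Λ (r • f) ≤ r * positivePart Λ f := by
  refine positivePart_le fun g hg => ?_
  have hle : r⁻¹ • g ≤ f := by
    intro x
    have hx : g x ≤ r * f x := hg x
    change r⁻¹ * g x ≤ f x
    rwa [inv_mul_le_iff₀ (pos_iff_ne_zero.2 hr)]
  have hg' : g.toReal = (r : ℝ) • (r⁻¹ • g).toReal := by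
    ext x
    have : (r : ℝ) ≠ 0 := by exact_mod_cast hr
    simp [NNReal.smul_def, this]
  rw [hg', map_smul, smul_eq_mul]
  exact mul_le_mul_of_nonneg_left (h.le_positivePart hle) r.2

theorem IsSupBounded.positivePart_smul (h : IsSupBounded Λ M) (r : ℝ≥0)
    (f : C_c(X, ℝ≥0)) : positivePart Λ (r • f) = r * positivePart Λ f := by
  rcases eq_or_ne r 0 with rfl | hr
  · have h0 : (0 : ℝ≥0) • f = 0 := by ext; simp
    -- Additivity at zero reads `p = p + p`, which forces `p = 0`.
    have h1 := h.positivePart_add 0 0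
    simp only [add_zero] at h1
    rw [h0]
    simp only [NNReal.coe_zero, zero_mul]
    linarith
  · refine le_antisymm (h.positivePart_smul_le hr f) ?_
    have h1 := h.positivePart_smul_le (inv_ne_zero hr) (r • f)
    have h2 : r⁻¹ • r • f = f := by rw [smul_smul, inv_mul_cancel₀ hr, one_smul]
    have hr' : (0 : ℝ) < r := by exact_mod_cast pos_iff_ne_zero.2 hr
    rw [h2, NNReal.coe_inv, ← div_eq_inv_mul, le_div_iff₀ hr'] at h1
    linarith

/-- The positive part of a bounded functional as a linear functional. -/
def IsSupBounded.positiveLinear (h : IsSupBounded Λ M) : C_c(X, ℝ≥0) →ₗ[ℝ≥0] ℝ≥0 where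
  toFun f := ⟨positivePart Λ f, h.positivePart_nonneg f⟩
  map_add' f g := NNReal.eq (h.positivePart_add f g)
  map_smul' r f := NNReal.eq (h.positivePart_smul r f)

theorem IsSupBounded.coe_positiveLinear (h : IsSupBounded Λ M) (f : C_c(X, ℝ≥0)) :
    (h.positiveLinear f : ℝ) = positivePart Λ f := rfl

/-- The complement `k = f - g` of a competitor `g` is again a competitor, and `Λ g = Λ f + (-Λ) k`.
Applied to both `Λ` and `-Λ`, this gives the Jordan decomposition. -/
theorem IsSupBounded.positivePart_le_add (h : IsSupBounded Λ M) (f : C_c(X, ℝ≥0)) :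
    positivePart Λ f ≤ Λ f.toReal + positivePart (-Λ) f := by
  refine positivePart_le fun g hg => ?_
  obtain ⟨k, rfl⟩ := CompactlySupportedContinuousMap.exists_add_of_le hg
  have hk : k ≤ g + k := fun x => le_add_of_nonneg_left zero_le
  have := h.neg.le_positivePart hk
  rw [toReal_add, map_add]
  simp only [LinearMap.neg_apply] at this
  linarith

/-- The Jordan decomposition of a bounded functional. -/
theorem IsSupBounded.positivePart_sub (h : IsSupBounded Λ M) (f : C_c(X, ℝ≥0)) :
    positivePart Λ f - positivePart (-Λ) f = Λ f.toReal := by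
  have h1 := h.positivePart_le_add f
  have h2 := h.neg.positivePart_le_add f
  simp only [neg_neg, LinearMap.neg_apply] at h2
  linarith

variable [T2Space X] [LocallyCompactSpace X] [MeasurableSpace X] [BorelSpace X]

/-- By inner regularity it is enough to bound compact sets, and a cutoff with values in `[0, 1]`
that equals `1` on the compact set has positive part at most `M`. -/
theorem IsSupBounded.isFiniteMeasure (h : IsSupBounded Λ M) :
    IsFiniteMeasure (NNRealRMK.rieszMeasure h.positiveLinear) := by
  have hreg : (NNRealRMK.rieszMeasure h.positiveLinear).Regular := inferInstance
  refine ⟨lt_of_le_of_lt (b := ENNReal.ofReal M) ?_ ENNReal.ofReal_lt_top⟩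
  rw [isOpen_univ.measure_eq_iSup_isCompact]
  refine iSup₂_le fun K _ => iSup_le fun hK => ?_
  obtain ⟨f, hf1, -, hfc, hf⟩ :=
    exists_continuous_one_zero_of_isCompact hK isClosed_empty (disjoint_empty K)
  let f' : C_c(X, ℝ) := ⟨f, hfc⟩
  have hone : ∀ x ∈ K, (1 : ENNReal) ≤ (f'.nnrealPart x : ENNReal) := by
    intro x hx
    have : f x = 1 := hf1 hx
    simp [nnrealPart_apply, f', this]
  calc NNRealRMK.rieszMeasure h.positiveLinear K
      = ∫⁻ _ in K, 1 ∂NNRealRMK.rieszMeasure h.positiveLinear := by simp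
    _ ≤ ∫⁻ x in K, f'.nnrealPart x ∂NNRealRMK.rieszMeasure h.positiveLinear :=
        setLIntegral_mono' hK.measurableSet hone
    _ ≤ ∫⁻ x, f'.nnrealPart x ∂NNRealRMK.rieszMeasure h.positiveLinear :=
        setLIntegral_le_lintegral _ _
    _ = h.positiveLinear f'.nnrealPart := NNRealRMK.lintegral_rieszMeasure _ _
    _ = ENNReal.ofReal (h.positiveLinear f'.nnrealPart : ℝ) := by simp
    _ ≤ ENNReal.ofReal M := by
        refine ENNReal.ofReal_le_ofReal ?_
        rw [h.coe_positiveLinear]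
        refine (h.positivePart_le_mul zero_le_one fun x => ?_).trans (mul_one M).le
        simpa [nnrealPart_apply, f'] using (hf x).2

/-- The Riesz representation theorem for bounded functionals on `C_c(X, ℝ)`. -/
theorem IsSupBounded.exists_signedMeasure (h : IsSupBounded Λ M) :
    ∃ σ : SignedMeasure X, ∀ f : C_c(X, ℝ),
      σ.integral f (ContinuousLinearMap.lsmul ℝ ℝ) = Λ f := by
  have := h.isFiniteMeasure
  have := h.neg.isFiniteMeasure
  set μ := NNRealRMK.rieszMeasure h.positiveLinear
  set ν := NNRealRMK.rieszMeasure h.neg.positiveLinear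
  refine ⟨μ.toSignedMeasure - ν.toSignedMeasure, fun f => ?_⟩
  have hflip : (ContinuousLinearMap.lsmul ℝ ℝ : ℝ →L[ℝ] ℝ →L[ℝ] ℝ) =
      (ContinuousLinearMap.lsmul ℝ ℝ : ℝ →L[ℝ] ℝ →L[ℝ] ℝ).flip := by
    ext
    simp
  rw [hflip, VectorMeasure.integral_sub_vectorMeasure, VectorMeasure.integral_toSignedMeasure,
    VectorMeasure.integral_toSignedMeasure]
  · have hsub : ∀ m : Measure X, IsFiniteMeasure m →
        ∫ x, f x ∂m = ∫ x, (f.nnrealPart x : ℝ) ∂m - ∫ x, ((-f).nnrealPart x : ℝ) ∂m := by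
      intro m _
      have hi : ∀ k : C_c(X, ℝ≥0), Integrable (fun x => (k x : ℝ)) m := fun k => by
        have hk : (fun x => (k x : ℝ)) = k.toReal := by ext; simp
        rw [hk]
        exact (map_continuous k.toReal).integrable_of_hasCompactSupport k.toReal.hasCompactSupport
      rw [← integral_sub (hi _) (hi _)]
      refine integral_congr_ae (.of_forall fun x => ?_)
      simp
    rw [hsub μ inferInstance, hsub ν inferInstance, NNRealRMK.integral_rieszMeasure,
      NNRealRMK.integral_rieszMeasure, NNRealRMK.integral_rieszMeasure,
      NNRealRMK.integral_rieszMeasure]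
    simp only [IsSupBounded.coe_positiveLinear]
    conv_rhs => rw [← nnrealPart_sub_nnrealPart_neg f, map_sub, ← h.positivePart_sub,
      ← h.positivePart_sub]
    ring
  all_goals
    simp only [VectorMeasure.Integrable, Measure.variation_toSignedMeasure]
    exact f.continuous.integrable_of_hasCompactSupport f.hasCompactSupport

/-- A linear functional on a space of compactly supported functions that is bounded in the supremum
norm is the integral against a signed measure. -/
theorem exists_signedMeasure_of_abs_le {V : Type*} [AddCommGroup V] [Module ℝ V]
    (T : V →ₗ[ℝ] C_c(X, ℝ)) (hT : Function.Injective T) (L : V →ₗ[ℝ] ℝ) {M : ℝ} (hM : 0 ≤ M)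
    (hL : ∀ v C, 0 ≤ C → (∀ x, |T v x| ≤ C) → L v ≤ M * C) :
    ∃ σ : SignedMeasure X, ∀ v, σ.integral (T v) (ContinuousLinearMap.lsmul ℝ ℝ) = L v := by
  -- The sublinear majorant for Hahn-Banach. Extending the functional avoids any density argument
  -- for the range of `T`.
  let N : C_c(X, ℝ) → ℝ := fun f => M * ‖(f : BoundedContinuousFunction X ℝ)‖
  let e := LinearEquiv.ofInjective T hT
  obtain ⟨Λ, hΛ, hN⟩ := exists_extension_of_le_sublinear
    ⟨LinearMap.range T, L ∘ₗ e.symm.toLinearMap⟩ N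
    (fun c hc f => by
      have : ((c • f : C_c(X, ℝ)) : BoundedContinuousFunction X ℝ) =
        c • (f : BoundedContinuousFunction X ℝ) := by ext; simp
      simp only [N, this, norm_smul, Real.norm_of_nonneg hc.le]
      ring)
    (fun f g => by
      have : ((f + g : C_c(X, ℝ)) : BoundedContinuousFunction X ℝ) =
        (f : BoundedContinuousFunction X ℝ) + (g : BoundedContinuousFunction X ℝ) := by ext; simp
      simp only [N, this, ← mul_add]
      exact mul_le_mul_of_nonneg_left (norm_add_le _ _) hM)
    (by
      rintro ⟨_, v, rfl⟩
      have : e.symm ⟨T v, ⟨v, rfl⟩⟩ = v := by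
        rw [LinearEquiv.symm_apply_eq]; rfl
      change L (e.symm ⟨T v, ⟨v, rfl⟩⟩) ≤ _
      rw [this]
      exact hL v _ (norm_nonneg _) fun x =>
        (T v : BoundedContinuousFunction X ℝ).norm_coe_le_norm x)
  have hb : IsSupBounded Λ M := fun f C hC hf => (hN f).trans <|
    mul_le_mul_of_nonneg_left ((BoundedContinuousFunction.norm_le hC).2 hf) hM
  obtain ⟨σ, hσ⟩ := hb.exists_signedMeasure
  refine ⟨σ, fun v => ?_⟩
  rw [hσ]
  refine (hΛ ⟨T v, ⟨v, rfl⟩⟩).trans ?_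
  change L (e.symm ⟨T v, ⟨v, rfl⟩⟩) = _
  congr 1
  rw [LinearEquiv.symm_apply_eq]; rfl

end Riesz

end NormalTrace

end

noncomputable section

namespace NormalTrace

open scoped Convolution ContDiff Manifold
open Filter

/-! ### Cutoffs and mollification of `W^{1,∞}_c` functions -/

section Sobolev

variable {n : ℕ}

theorem MemW1InftyCompact.continuous {A : Opens (EuclideanSpace ℝ (Fin n))}
    {φ : EuclideanSpace ℝ (Fin n) → ℝ} (h : MemW1InftyCompact A φ) : Continuous φ :=
  h.1.1.continuous_of_tsupport_subset A.isOpen h.2.2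

theorem MemW1InftyCompact.exists_abs_le {A : Opens (EuclideanSpace ℝ (Fin n))}
    {φ : EuclideanSpace ℝ (Fin n) → ℝ} (h : MemW1InftyCompact A φ) :
    ∃ C, 0 ≤ C ∧ ∀ x, |φ x| ≤ C := by
  obtain ⟨C, hC⟩ := h.continuous.bounded_above_of_compact_support h.2.1
  exact ⟨C, (norm_nonneg _).trans (hC 0), hC⟩

/-- A smooth cutoff function that equals `1` on a given compact subset of an open set. -/
theorem exists_contDiff_cutoff {K : Set (EuclideanSpace ℝ (Fin n))} (hK : IsCompact K)
    {A : Opens (EuclideanSpace ℝ (Fin n))} (hKA : K ⊆ A) :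
    ∃ η : EuclideanSpace ℝ (Fin n) → ℝ, ContDiff ℝ ∞ η ∧ HasCompactSupport η ∧ tsupport η ⊆ A ∧
      (∀ x ∈ K, η x = 1) ∧ ∀ x, |η x| ≤ 1 := by
  obtain ⟨K', hK', hKK', hK'A⟩ := exists_compact_between hK A.isOpen hKA
  obtain ⟨η, h1, h0, hη⟩ := exists_contMDiffMap_one_nhds_of_subset_interior
    (n := (⊤ : ℕ∞)) 𝓘(ℝ, EuclideanSpace ℝ (Fin n)) hK.isClosed hKK'
  have hsupp : tsupport η ⊆ K' := by
    refine closure_minimal (fun x hx => ?_) hK'.isClosed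
    by_contra hxK
    exact hx (h0 x hxK)
  refine ⟨η, η.contMDiff.contDiff, hK'.of_isClosed_subset (isClosed_tsupport _) hsupp,
    hsupp.trans hK'A, fun x hx => h1.self_of_nhdsSet x hx, fun x => ?_⟩
  rw [abs_of_nonneg (hη x).1]
  exact (hη x).2

/-- Testing the weak gradient against functions whose support need not lie in `A`. -/
theorem MemW1InftyCompact.norm_integral_smul_fderiv_le {A : Opens (EuclideanSpace ℝ (Fin n))}
    {φ : EuclideanSpace ℝ (Fin n) → ℝ} (h : MemW1InftyCompact A φ) :
    ∃ G, 0 ≤ G ∧ ∀ ψ : EuclideanSpace ℝ (Fin n) → ℝ, ContDiff ℝ ∞ ψ → HasCompactSupport ψ →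
      ‖∫ y, φ y • fderiv ℝ ψ y‖ ≤ G * ∫ y, |ψ y| := by
  obtain ⟨g, hg, hweak⟩ := h.1.2.2
  obtain ⟨η, hη, hηc, hηA, hη1, hηle⟩ := exists_contDiff_cutoff h.2.1 h.2.2
  refine ⟨(eLpNorm g ⊤ (volume.restrict A)).toReal, ENNReal.toReal_nonneg, fun ψ hψ hψc => ?_⟩
  -- Since `η = 1` on the support of `φ`, replacing `ψ` by `ηψ` leaves `φ∇ψ` unchanged and produces
  -- a test function in `A`, against which the weak gradient may be used.
  let ζ : 𝓓(A, ℝ) := ⟨fun y => η y * ψ y, hη.mul hψ, hψc.mul_left,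
    (tsupport_mul_subset_left).trans hηA⟩
  have heq : ∀ y, φ y • fderiv ℝ ψ y = φ y • fderiv ℝ ζ y := by
    intro y
    by_cases hy : φ y = 0
    · simp [hy]
    · congr 1
      refine (Filter.EventuallyEq.fderiv_eq ?_).symm
      filter_upwards [(isOpen_ne_fun h.continuous continuous_const).mem_nhds hy] with z hz
      change η z * ψ z = ψ z
      rw [hη1 z (subset_tsupport φ hz), one_mul]
  have hA : ∫ y, φ y • fderiv ℝ ψ y = ∫ y in A, φ y • fderiv ℝ ζ y := by
    simp only [heq]
    refine (setIntegral_eq_integral_of_forall_compl_eq_zero fun y hy => ?_).symm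
    rw [image_eq_zero_of_notMem_tsupport fun hy' => hy (h.2.2 hy'), zero_smul]
  rw [hA, hweak ζ, norm_neg]
  have hgle : ∀ᵐ y ∂volume.restrict (A : Set (EuclideanSpace ℝ (Fin n))),
      ‖g y‖ ≤ (eLpNorm g ⊤ (volume.restrict A)).toReal := by
    filter_upwards [ae_le_eLpNormEssSup (f := g) (μ := volume.restrict A)] with y hy
    rw [← toReal_enorm]
    refine ENNReal.toReal_mono hg.2.ne ?_
    rwa [eLpNorm_exponent_top]
  have hψi : Integrable (fun y => |ψ y|) := (hψ.continuous.integrable_of_hasCompactSupport hψc).abs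
  calc ‖∫ y in A, ζ y • g y‖
      ≤ ∫ y in A, (eLpNorm g ⊤ (volume.restrict A)).toReal * |ψ y| := by
        refine norm_integral_le_of_norm_le (hψi.const_mul _).restrict ?_
        filter_upwards [hgle] with y hy
        rw [norm_smul, mul_comm]
        refine mul_le_mul hy ?_ (norm_nonneg _) ENNReal.toReal_nonneg
        change |η y * ψ y| ≤ _
        rw [abs_mul]
        exact mul_le_of_le_one_left (abs_nonneg _) (hηle y)
    _ ≤ ∫ y, (eLpNorm g ⊤ (volume.restrict A)).toReal * |ψ y| :=
        setIntegral_le_integral (hψi.const_mul _)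
          (.of_forall fun y => mul_nonneg ENNReal.toReal_nonneg (abs_nonneg _))
    _ = _ := integral_const_mul _ _

/-- Functions in `W^{1,∞}_c(A)` are pointwise limits of smooth functions that are uniformly bounded
together with their gradients. -/
theorem MemW1InftyCompact.exists_smooth_approx {A : Opens (EuclideanSpace ℝ (Fin n))}
    {φ : EuclideanSpace ℝ (Fin n) → ℝ} (h : MemW1InftyCompact A φ) :
    ∃ (C G : ℝ) (u : ℕ → EuclideanSpace ℝ (Fin n) → ℝ), 0 ≤ C ∧ (∀ k, ContDiff ℝ ∞ (u k)) ∧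
      (∀ k x, |u k x| ≤ C) ∧ (∀ k x, ‖fderiv ℝ (u k) x‖ ≤ G) ∧
      ∀ x, Tendsto (fun k => u k x) atTop (nhds (φ x)) := by
  obtain ⟨C, hC0, hC⟩ := h.exists_abs_le
  obtain ⟨G, hG0, hG⟩ := h.norm_integral_smul_fderiv_le
  have hφi : LocallyIntegrable φ := h.continuous.locallyIntegrable
  -- Mollifiers with outer radius `1/(k+1)`. Only their unit mass, positivity and shrinking supports
  -- matter.
  let b : ℕ → ContDiffBump (0 : EuclideanSpace ℝ (Fin n)) := fun k =>
    ⟨1 / (k + 1) / 2, 1 / (k + 1), by positivity, half_lt_self (by positivity)⟩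
  let ρ : ℕ → EuclideanSpace ℝ (Fin n) → ℝ := fun k => (b k).normed volume
  have hρ : ∀ k, ContDiff ℝ ∞ (ρ k) := fun k => (b k).contDiff_normed
  have hρc : ∀ k, HasCompactSupport (ρ k) := fun k => (b k).hasCompactSupport_normed
  have hρabs : ∀ k y, |ρ k y| = ρ k y := fun k y => abs_of_nonneg ((b k).nonneg_normed y)
  have hρi : ∀ k, ∫ y, ρ k y = 1 := fun k => (b k).integral_normed
  refine ⟨C, G, fun k => ρ k ⋆[ContinuousLinearMap.lsmul ℝ ℝ, volume] φ, hC0,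
    fun k => (hρc k).contDiff_convolution_left _ (hρ k) hφi, fun k x => ?_, fun k x => ?_,
    fun x => ?_⟩
  · change ‖∫ t, ContinuousLinearMap.lsmul ℝ ℝ (ρ k t) (φ (x - t))‖ ≤ C
    calc ‖∫ t, ContinuousLinearMap.lsmul ℝ ℝ (ρ k t) (φ (x - t))‖
        ≤ ∫ t, ρ k t * C := by
          refine norm_integral_le_of_norm_le ((b k).integrable_normed.mul_const C)
            (.of_forall fun t => ?_)
          rw [ContinuousLinearMap.lsmul_apply, norm_smul, Real.norm_eq_abs, Real.norm_eq_abs, hρabs]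
          exact mul_le_mul_of_nonneg_left (hC _) ((b k).nonneg_normed t)
      _ = C := by rw [integral_mul_const, hρi, one_mul]
  · have hd := ((hρc k).hasFDerivAt_convolution_left (ContinuousLinearMap.lsmul ℝ ℝ)
      ((hρ k).of_le (by simp)) hφi x).fderiv
    rw [hd, convolution_def]
    have hsub : ∀ y, fderiv ℝ (fun z => ρ k (x - z)) y = -fderiv ℝ (ρ k) (x - y) := fun y => by
      have h0 : HasFDerivAt (ρ k) (fderiv ℝ (ρ k) (x - y)) (x - y) :=
        ((hρ k).differentiable (by simp) _).hasFDerivAt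
      refine (h0.comp y ((hasFDerivAt_id y).const_sub x)).fderiv.trans ?_
      ext v
      simp
    -- The substitution `t = x - y` turns the gradient of the mollification into a weak-gradient
    -- test against `y ↦ ρ k (x - y)`, whose `L¹` norm is one; hence the bound `G`.
    have h1 : ∫ t, ((ContinuousLinearMap.lsmul ℝ ℝ).precompL (EuclideanSpace ℝ (Fin n)))
        (fderiv ℝ (ρ k) t) (φ (x - t)) = -∫ y, φ y • fderiv ℝ (fun z => ρ k (x - z)) y := by
      rw [← integral_neg, ← integral_sub_left_eq_self _ volume x]
      refine integral_congr_ae (.of_forall fun y => ?_)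
      ext v
      simp [hsub, mul_comm, ContinuousLinearMap.precompL_apply]
    rw [h1, norm_neg]
    refine (hG _ ((hρ k).comp (contDiff_const.sub contDiff_id))
      ((hρc k).comp_homeomorph (Homeomorph.subLeft x))).trans (le_of_eq ?_)
    have h2 : ∫ y, |ρ k (x - y)| = 1 := by
      rw [integral_sub_left_eq_self (fun y => |ρ k y|) volume x]
      simp only [hρabs, hρi]
    change G * ∫ y, |ρ k (x - y)| = G
    rw [h2, mul_one]
  · exact ContDiffBump.convolution_tendsto_right_of_continuous
      (tendsto_one_div_add_atTop_nhds_zero_nat) h.continuous x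

end Sobolev

end NormalTrace

end

noncomputable section

namespace NormalTrace

open scoped CompactlySupported ContDiff
open Filter

/-! ### Divergence-measure fields: existence, products and uniqueness -/

section Fields

variable {n : ℕ} {Ω : Opens (EuclideanSpace ℝ (Fin n))}

theorem gradIntegral_self (F : FieldMeasure Ω) (φ : EuclideanSpace ℝ (Fin n) → ℝ) :
    gradIntegral F Ω φ = F.integral (fun x : Ω => fderiv ℝ φ x)
      (ContinuousLinearMap.id ℝ (EuclideanSpace ℝ (Fin n) →L[ℝ] ℝ)) := by
  rw [gradIntegral, Subtype.coe_preimage_self, VectorMeasure.restrict_univ]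

theorem scalarIntegral_self (σ : ScalarMeasure Ω) (φ : EuclideanSpace ℝ (Fin n) → ℝ) :
    scalarIntegral σ Ω φ = σ.integral (fun x : Ω => φ x) (ContinuousLinearMap.lsmul ℝ ℝ) := by
  rw [scalarIntegral, Subtype.coe_preimage_self, VectorMeasure.restrict_univ]

theorem exists_norm_fderiv_le {φ : EuclideanSpace ℝ (Fin n) → ℝ} (hφ : ContDiff ℝ 1 φ)
    (hc : HasCompactSupport φ) : ∃ D, ∀ x, ‖fderiv ℝ φ x‖ ≤ D :=
  (hφ.continuous_fderiv (by simp)).bounded_above_of_compact_support (hc.fderiv ℝ)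

theorem continuous_fderiv_coe {φ : EuclideanSpace ℝ (Fin n) → ℝ} (hφ : ContDiff ℝ 1 φ) :
    Continuous fun x : Ω => fderiv ℝ φ x :=
  (hφ.continuous_fderiv (by simp)).comp continuous_subtype_val

theorem integrable_fderiv (F : FieldMeasure Ω) {φ : EuclideanSpace ℝ (Fin n) → ℝ}
    (hφ : ContDiff ℝ 1 φ) (hc : HasCompactSupport φ) :
    F.Integrable fun x : Ω => fderiv ℝ φ x := by
  obtain ⟨D, hD⟩ := exists_norm_fderiv_le hφ hc
  exact .of_bound (continuous_fderiv_coe hφ).aestronglyMeasurable D (.of_forall fun x => hD x)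

theorem gradIntegral_add (F : FieldMeasure Ω) {φ ψ : EuclideanSpace ℝ (Fin n) → ℝ}
    (hφ : ContDiff ℝ 1 φ) (hφc : HasCompactSupport φ) (hψ : ContDiff ℝ 1 ψ)
    (hψc : HasCompactSupport ψ) :
    gradIntegral F Ω (φ + ψ) = gradIntegral F Ω φ + gradIntegral F Ω ψ := by
  simp only [gradIntegral_self]
  rw [← VectorMeasure.integral_fun_add (integrable_fderiv F hφ hφc) (integrable_fderiv F hψ hψc)]
  congr 1
  ext1 x
  exact fderiv_add (hφ.differentiable (by simp) _) (hψ.differentiable (by simp) _)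

theorem gradIntegral_smul (F : FieldMeasure Ω) {φ : EuclideanSpace ℝ (Fin n) → ℝ}
    (hφ : ContDiff ℝ 1 φ) (c : ℝ) :
    gradIntegral F Ω (c • φ) = c * gradIntegral F Ω φ := by
  simp only [gradIntegral_self]
  rw [← smul_eq_mul, ← VectorMeasure.integral_fun_smul]
  congr 1
  ext1 x
  exact fderiv_const_smul (hφ.differentiable (by simp) _) c

/-- The integral of a gradient against a field in `DM^ext` is controlled by the supremum norm. -/
theorem IsDivergenceMeasureField.exists_gradIntegral_le {F : FieldMeasure Ω}
    (hF : IsDivergenceMeasureField F) :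
    ∃ M, 0 ≤ M ∧ ∀ (ψ : 𝓓^{1}(Ω, ℝ)) (C : ℝ), 0 ≤ C → (∀ x, |ψ x| ≤ C) →
      gradIntegral F Ω ψ ≤ M * C := by
  obtain ⟨M, hM⟩ := hF
  -- The zero test function is a competitor in the supremum.
  have hM0 : 0 ≤ M := hM ⟨0, by simp, by simp [gradIntegral_self]⟩
  refine ⟨M, hM0, fun ψ C hC hψ => ?_⟩
  rcases hC.eq_or_lt with rfl | hC
  · have h0 : (ψ : EuclideanSpace ℝ (Fin n) → ℝ) = 0 := by
      ext x
      exact abs_nonpos_iff.1 (hψ x)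
    simp [gradIntegral_self, h0]
  · have h1 : gradIntegral F Ω (C⁻¹ • ψ) ≤ M := by
      refine hM ⟨C⁻¹ • ψ, fun x => ?_, rfl⟩
      change |C⁻¹ * ψ x| ≤ 1
      rw [abs_mul, abs_of_pos (inv_pos.2 hC), inv_mul_le_iff₀ hC, mul_one]
      exact hψ x
    rw [gradIntegral_smul F ψ.contDiff, inv_mul_le_iff₀ hC] at h1
    rwa [mul_comm]

/-- The restriction of a test function to `Ω`, as a compactly supported function. -/
def restrictTestFunction (Ω : Opens (EuclideanSpace ℝ (Fin n))) :
    𝓓(Ω, ℝ) →ₗ[ℝ] C_c(Ω, ℝ) where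
  toFun ψ :=
    { toFun := fun x => ψ x
      continuous_toFun := ψ.continuous.comp continuous_subtype_val
      hasCompactSupport' := by
        have hK : IsCompact ((↑) ⁻¹' tsupport ψ : Set Ω) :=
          Topology.IsInducing.subtypeVal.isCompact_preimage' ψ.hasCompactSupport
            (by simpa using ψ.tsupport_subset)
        refine hK.of_isClosed_subset (isClosed_tsupport _) (closure_minimal (fun x hx => ?_) ?_)
        · exact subset_tsupport ψ hx
        · exact (isClosed_tsupport _).preimage continuous_subtype_val }
  map_add' _ _ := rfl
  map_smul' _ _ := rfl

theorem restrictTestFunction_apply (ψ : 𝓓(Ω, ℝ)) (x : Ω) : restrictTestFunction Ω ψ x = ψ x := rfl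

theorem abs_testFunction_le {k : ℕ∞} (ψ : 𝓓^{k}(Ω, ℝ)) {C : ℝ} (hC : 0 ≤ C)
    (h : ∀ x : Ω, |ψ x| ≤ C) (x : EuclideanSpace ℝ (Fin n)) : |ψ x| ≤ C := by
  by_cases hx : x ∈ Ω
  · exact h ⟨x, hx⟩
  · rw [image_eq_zero_of_notMem_tsupport fun hx' => hx (ψ.tsupport_subset hx'), abs_zero]
    exact hC

theorem restrictTestFunction_injective : Function.Injective (restrictTestFunction Ω) := by
  rw [injective_iff_map_eq_zero]
  intro ψ hψ
  ext x
  refine abs_nonpos_iff.1 (abs_testFunction_le ψ le_rfl (fun y => ?_) x)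
  rw [← restrictTestFunction_apply, hψ]
  simp

/-- The functional `φ ↦ -∫_Ω ∇φ · dF`, the distributional divergence of `F`. -/
def divergenceFunctional (F : FieldMeasure Ω) : 𝓓(Ω, ℝ) →ₗ[ℝ] ℝ where
  toFun ψ := -gradIntegral F Ω ψ
  map_add' φ ψ := by
    rw [FunLike.coe_add, gradIntegral_add F (φ.contDiff.of_le (by simp)) φ.hasCompactSupport
      (ψ.contDiff.of_le (by simp)) ψ.hasCompactSupport]
    ring
  map_smul' c ψ := by
    rw [FunLike.coe_smul, gradIntegral_smul F (ψ.contDiff.of_le (by simp))]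
    simp

/-- The distributional divergence of a field in `DM^ext(Ω)` is a finite signed measure. -/
theorem IsDivergenceMeasureField.exists_hasDivergence {F : FieldMeasure Ω}
    (hF : IsDivergenceMeasureField F) : ∃ σ : ScalarMeasure Ω, HasDivergence F σ := by
  obtain ⟨M, hM, hle⟩ := hF.exists_gradIntegral_le
  have := Ω.isOpen.locallyCompactSpace
  obtain ⟨σ, hσ⟩ := exists_signedMeasure_of_abs_le (restrictTestFunction Ω)
    restrictTestFunction_injective (divergenceFunctional F) hM fun ψ C hC hψ => by
      have hneg : divergenceFunctional F ψ = gradIntegral F Ω (-ψ) := by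
        have := (divergenceFunctional F).map_neg ψ
        rw [← neg_inj, ← this]
        rfl
      rw [hneg]
      refine hle ⟨-ψ, (-ψ).contDiff.of_le (by simp), (-ψ).hasCompactSupport,
        (-ψ).tsupport_subset⟩ C hC fun x => ?_
      change |-ψ x| ≤ C
      rw [abs_neg]
      exact abs_testFunction_le ψ hC hψ x
  exact ⟨σ, fun ψ => (scalarIntegral_self σ ψ).trans (hσ ψ)⟩

theorem IsDivergenceMeasureField.hasDivergence_divergence {F : FieldMeasure Ω}
    (hF : IsDivergenceMeasureField F) : HasDivergence F (divergence F) := by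
  have h := hF.exists_hasDivergence
  rw [divergence, dif_pos h]
  exact h.choose_spec

theorem gradIntegral_mulField (F : FieldMeasure Ω) {φ ψ : EuclideanSpace ℝ (Fin n) → ℝ}
    (hφ : Continuous φ) {C : ℝ} (hC : ∀ x, |φ x| ≤ C) (hψ : ContDiff ℝ 1 ψ)
    (hψc : HasCompactSupport ψ) :
    gradIntegral (mulField φ F) Ω ψ = F.integral (fun x : Ω => φ x • fderiv ℝ ψ x)
      (ContinuousLinearMap.id ℝ (EuclideanSpace ℝ (Fin n) →L[ℝ] ℝ)) := by
  obtain ⟨D, hD⟩ := exists_norm_fderiv_le hψ hψc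
  rw [gradIntegral_self, mulField]
  exact integral_withDensity_lsmul F (hφ.comp continuous_subtype_val).measurable
    (fun x => hC x) (continuous_fderiv_coe hψ).stronglyMeasurable (fun x => hD x) _

/-- `DM^ext(Ω)` is stable under multiplication by functions in `W^{1,∞}_c(A)`. -/
theorem IsDivergenceMeasureField.mulField {F : FieldMeasure Ω} (hF : IsDivergenceMeasureField F)
    {A : Opens (EuclideanSpace ℝ (Fin n))} {φ : EuclideanSpace ℝ (Fin n) → ℝ}
    (hφ : MemW1InftyCompact A φ) : IsDivergenceMeasureField (mulField φ F) := by
  obtain ⟨M, hM, hle⟩ := hF.exists_gradIntegral_le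
  obtain ⟨C, G, u, hC0, hu, huC, huG, hlim⟩ := hφ.exists_smooth_approx
  obtain ⟨C', -, hC'⟩ := hφ.exists_abs_le
  -- `M * C` bounds the contribution of `∇(uψ)`, and the second term bounds that of `ψ∇u` by the
  -- total variation of `F`.
  refine ⟨M * C + G * ‖ContinuousLinearMap.id ℝ (EuclideanSpace ℝ (Fin n) →L[ℝ] ℝ)‖ *
    F.variation.real univ, ?_⟩
  rintro _ ⟨ψ, hψ, rfl⟩
  rw [gradIntegral_mulField F hφ.continuous hC' ψ.contDiff ψ.hasCompactSupport]
  obtain ⟨D, hD⟩ := exists_norm_fderiv_le ψ.contDiff ψ.hasCompactSupport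
  have hu1 : ∀ k, ContDiff ℝ 1 (u k) := fun k => (hu k).of_le (by simp)
  have hmeas : ∀ k, Continuous fun x : Ω => u k x • fderiv ℝ ψ x := fun k =>
    ((hu k).continuous.comp continuous_subtype_val).smul (continuous_fderiv_coe ψ.contDiff)
  have hbound : ∀ k (x : Ω), ‖u k x • fderiv ℝ ψ x‖ ≤ C * D := fun k x => by
    rw [norm_smul]
    exact mul_le_mul (huC k x) (hD x) (norm_nonneg _) hC0
  have htends : Tendsto (fun k => F.integral (fun x : Ω => u k x • fderiv ℝ ψ x)
      (ContinuousLinearMap.id ℝ (EuclideanSpace ℝ (Fin n) →L[ℝ] ℝ))) atTop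
      (nhds (F.integral (fun x : Ω => φ x • fderiv ℝ ψ x)
        (ContinuousLinearMap.id ℝ (EuclideanSpace ℝ (Fin n) →L[ℝ] ℝ)))) :=
    VectorMeasure.tendsto_integral_filter_of_norm_le_const
      (.of_forall fun k => (hmeas k).aestronglyMeasurable)
      ⟨C * D, .of_forall fun k => .of_forall (hbound k)⟩
      (.of_forall fun x => (hlim x).smul_const _)
  refine le_of_tendsto' htends fun k => ?_
  -- The product is admissible thanks to the compact support of `ψ` in `Ω`; the mollification itself
  -- need not be supported in `Ω`.
  let ζ : 𝓓^{1}(Ω, ℝ) := ⟨fun x => u k x * ψ x, (hu1 k).mul ψ.contDiff,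
    ψ.hasCompactSupport.mul_left, tsupport_mul_subset_right.trans ψ.tsupport_subset⟩
  have hζ : ∀ x, fderiv ℝ ζ x = u k x • fderiv ℝ ψ x + ψ x • fderiv ℝ (u k) x := fun x =>
    fderiv_mul ((hu1 k).differentiable (by simp) x) (ψ.contDiff.differentiable (by simp) x)
  have hb : ∀ x : Ω, ‖-ψ x • fderiv ℝ (u k) x‖ ≤ G := fun x => by
    rw [norm_smul, norm_neg]
    exact (mul_le_of_le_one_left (norm_nonneg _) (hψ x)).trans (huG k x)
  have hi : F.Integrable fun x : Ω => -ψ x • fderiv ℝ (u k) x :=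
    .of_bound ((ψ.continuous.comp continuous_subtype_val).neg.smul
      (continuous_fderiv_coe (hu1 k))).aestronglyMeasurable G (.of_forall hb)
  have hsplit : F.integral (fun x : Ω => u k x • fderiv ℝ ψ x)
      (ContinuousLinearMap.id ℝ (EuclideanSpace ℝ (Fin n) →L[ℝ] ℝ)) =
      gradIntegral F Ω ζ + F.integral (fun x : Ω => -ψ x • fderiv ℝ (u k) x)
        (ContinuousLinearMap.id ℝ (EuclideanSpace ℝ (Fin n) →L[ℝ] ℝ)) := by
    rw [gradIntegral_self, ← VectorMeasure.integral_fun_add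
      (integrable_fderiv F ζ.contDiff ζ.hasCompactSupport) hi]
    congr 1
    ext1 x
    rw [hζ, neg_smul, add_neg_cancel_right]
  rw [hsplit]
  refine add_le_add (hle ζ C hC0 fun x => ?_) ?_
  · change |u k x * ψ x| ≤ C
    rw [abs_mul]
    exact (mul_le_of_le_one_right (abs_nonneg _) (hψ x)).trans (huC k x)
  · exact (le_abs_self _).trans (VectorMeasure.norm_integral_le_of_norm_le_const (μ := F)
      (B := ContinuousLinearMap.id ℝ (EuclideanSpace ℝ (Fin n) →L[ℝ] ℝ)) (.of_forall hb))

/-- A signed measure on `Ω` that annihilates all test functions supported in the open set `W`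
vanishes on subsets of `W`. -/
theorem apply_eq_zero_of_scalarIntegral_eq_zero {σ : ScalarMeasure Ω}
    {W : Set (EuclideanSpace ℝ (Fin n))} (hW : IsOpen W)
    (h : ∀ ψ : 𝓓(Ω, ℝ), tsupport ψ ⊆ W → scalarIntegral σ Ω ψ = 0) {S : Set Ω}
    (hS : S ⊆ (↑) ⁻¹' W) : σ S = 0 := by
  classical
  obtain ⟨P, hP, hP0, hPc⟩ := σ.toJordanDecomposition.mutuallySingular
  have hemb : MeasurableEmbedding ((↑) : Ω → EuclideanSpace ℝ (Fin n)) :=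
    .subtype_coe Ω.isOpen.measurableSet
  have : IsFiniteMeasure σ.totalVariation := by
    unfold SignedMeasure.totalVariation
    infer_instance
  let m := σ.totalVariation.map ((↑) : Ω → EuclideanSpace ℝ (Fin n))
  -- The sign of `σ` from its Hahn decomposition: `σ` is `f` times its total variation. The
  -- hypothesis forces `f = 0` almost everywhere on `W ∩ Ω`, whereas `f` takes only the values `±1`,
  -- so the total variation of that set is zero. Pushing forward to the whole space gives access to
  -- the vanishing criterion for smooth tests.
  let f : EuclideanSpace ℝ (Fin n) → ℝ := (((↑) : Ω → EuclideanSpace ℝ (Fin n)) '' P).piecewise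
    (fun _ => -1) (fun _ => 1)
  have hfm : Measurable f :=
    Measurable.piecewise (hemb.measurableSet_image' hP) measurable_const measurable_const
  have hf1 : ∀ x, ‖f x‖ ≤ 1 := fun x => by
    by_cases hx : x ∈ ((↑) : Ω → EuclideanSpace ℝ (Fin n)) '' P <;> simp [f, hx]
  have hfi : Integrable f m := .of_bound hfm.aestronglyMeasurable 1 (.of_forall hf1)
  have hfP : ∀ x : Ω, f x = if x ∈ P then -1 else 1 := fun x => by
    by_cases hx : x ∈ P <;> simp [f, hx]
  have hae := (hW.inter Ω.isOpen).ae_eq_zero_of_integral_contDiff_smul_eq_zero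
    (hfi.locallyIntegrable.locallyIntegrableOn _) fun g hg hgc hgs => by
      have hgσ := h ⟨g, hg, hgc, hgs.trans inter_subset_right⟩ (hgs.trans inter_subset_left)
      obtain ⟨D, hD⟩ := hg.continuous.bounded_above_of_compact_support hgc
      have hgm : Measurable fun x : Ω => g x :=
        (hg.continuous.comp continuous_subtype_val).measurable
      have hgi : ∀ (μ : Measure Ω) [IsFiniteMeasure μ], Integrable (fun x : Ω => g x) μ :=
        fun μ _ => .of_bound hgm.aestronglyMeasurable D (.of_forall fun x => hD x)
      have hgfi : ∀ (μ : Measure Ω) [IsFiniteMeasure μ],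
          Integrable (fun x : Ω => g x • f x) μ := fun μ _ =>
        .of_bound (hgm.smul (hfm.comp measurable_subtype_coe)).aestronglyMeasurable (D * 1)
          (.of_forall fun x => by
            rw [norm_smul]
            exact mul_le_mul (hD x) (hf1 x) (norm_nonneg _) ((norm_nonneg _).trans (hD x)))
      rw [scalarIntegral_self] at hgσ
      have hσ := signedMeasure_integral_eq_sub σ (hgi _)
      change σ.integral (fun x : Ω => g x) _ = 0 at hgσ
      rw [hgσ] at hσ
      rw [hemb.integral_map, SignedMeasure.totalVariation, integral_add_measure (hgfi _) (hgfi _)]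
      have hpos : ∫ x : Ω, g x • f x ∂σ.toJordanDecomposition.posPart =
          ∫ x : Ω, g x ∂σ.toJordanDecomposition.posPart := by
        refine integral_congr_ae ?_
        filter_upwards [measure_eq_zero_iff_ae_notMem.1 hP0] with x hx
        simp [hfP, hx]
      have hneg : ∫ x : Ω, g x • f x ∂σ.toJordanDecomposition.negPart =
          -∫ x : Ω, g x ∂σ.toJordanDecomposition.negPart := by
        rw [← integral_neg]
        refine integral_congr_ae ?_
        filter_upwards [measure_eq_zero_iff_ae_notMem.1 hPc] with x hx
        have : x ∈ P := not_not.1 hx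
        simp [hfP, this]
      rw [hpos, hneg]
      linarith
  have hW0 : m (W ∩ Ω) = 0 := by
    rw [measure_eq_zero_iff_ae_notMem]
    filter_upwards [hae] with x hx hxW
    have := hx hxW
    by_cases hxP : x ∈ ((↑) : Ω → EuclideanSpace ℝ (Fin n)) '' P <;> simp [f, hxP] at this
  rw [hemb.map_apply] at hW0
  have hS' : S ⊆ (↑) ⁻¹' (W ∩ Ω) := fun x hx => ⟨hS hx, x.2⟩
  have hS0 : σ.totalVariation S = 0 := measure_mono_null hS' hW0
  have := σ.enorm_le_totalVariation S
  rw [hS0] at this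
  simpa using this

/-! ### Locality of integrals, traces and boundaries -/

theorem gradIntegral_congr_set (F : FieldMeasure Ω) {U V A : Set (EuclideanSpace ℝ (Fin n))}
    (hU : MeasurableSet U) (hV : MeasurableSet V) (hUV : U ∩ A = V ∩ A)
    {ψ : EuclideanSpace ℝ (Fin n) → ℝ} (hψ : tsupport ψ ⊆ A) :
    gradIntegral F U ψ = gradIntegral F V ψ := by
  refine restrict_integral_congr_set (hU.preimage measurable_subtype_coe)
    (hV.preimage measurable_subtype_coe) (fun x hx => ?_) _
  have hxA : (x : EuclideanSpace ℝ (Fin n)) ∈ A := hψ (support_fderiv_subset ℝ hx)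
  have := Set.ext_iff.1 hUV x
  simpa [hxA] using this

theorem scalarIntegral_congr_set (σ : ScalarMeasure Ω) {U V A : Set (EuclideanSpace ℝ (Fin n))}
    (hU : MeasurableSet U) (hV : MeasurableSet V) (hUV : U ∩ A = V ∩ A)
    {ψ : EuclideanSpace ℝ (Fin n) → ℝ} (hψ : tsupport ψ ⊆ A) :
    scalarIntegral σ U ψ = scalarIntegral σ V ψ := by
  refine restrict_integral_congr_set (hU.preimage measurable_subtype_coe)
    (hV.preimage measurable_subtype_coe) (fun x hx => ?_) _
  have hxA : (x : EuclideanSpace ℝ (Fin n)) ∈ A := hψ (subset_tsupport ψ hx)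
  have := Set.ext_iff.1 hUV x
  simpa [hxA] using this

/-- The normal trace distribution on `∂E` depends near a point only on `E` near that point. -/
theorem normalTraceDistribution_congr_set (F : FieldMeasure Ω)
    {U V A : Set (EuclideanSpace ℝ (Fin n))} (hU : MeasurableSet U) (hV : MeasurableSet V)
    (hUV : U ∩ A = V ∩ A) {ψ : EuclideanSpace ℝ (Fin n) → ℝ} (hψ : tsupport ψ ⊆ A) :
    normalTraceDistribution F U ψ = normalTraceDistribution F V ψ := by
  rw [normalTraceDistribution, normalTraceDistribution, gradIntegral_congr_set F hU hV hUV hψ,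
    scalarIntegral_congr_set _ hU hV hUV hψ]

/-- The divergence of `φ F` vanishes away from the support of `φ`. -/
theorem HasDivergence.apply_eq_zero_of_disjoint {F : FieldMeasure Ω}
    {φ : EuclideanSpace ℝ (Fin n) → ℝ} (hφ : Continuous φ) {C : ℝ} (hC : ∀ x, |φ x| ≤ C)
    {σ : ScalarMeasure Ω} (hσ : HasDivergence (NormalTrace.mulField φ F) σ) {S : Set Ω}
    (hS : S ⊆ (↑) ⁻¹' (tsupport φ)ᶜ) : σ S = 0 := by
  refine apply_eq_zero_of_scalarIntegral_eq_zero (isClosed_tsupport φ).isOpen_compl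
    (fun ψ hψ => ?_) hS
  rw [hσ ψ, gradIntegral_mulField F hφ hC (ψ.contDiff.of_le (by simp)) ψ.hasCompactSupport]
  -- On the support of `φ` the gradient of `ψ` vanishes, because `ψ` is supported in its complement;
  -- elsewhere `φ` vanishes.
  have hzero : (fun x : Ω => φ x • fderiv ℝ ψ x) = fun _ => 0 := by
    ext1 x
    by_cases hx : (x : EuclideanSpace ℝ (Fin n)) ∈ tsupport φ
    · rw [image_eq_zero_of_notMem_tsupport (f := fderiv ℝ ψ)
        (fun hx' => hψ (tsupport_fderiv_subset ℝ hx') hx), smul_zero]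
    · rw [image_eq_zero_of_notMem_tsupport hx, zero_smul]
  rw [hzero, VectorMeasure.integral_zero, neg_zero]

/-- The frontier is the intersection of the closures of the set and of its complement. Complements
also agree inside `A`, and membership of a point of `A` in a closure is decided inside the open set
`A`. -/
theorem inter_frontier_subset {X : Type*} [TopologicalSpace X] {U V A : Set X} (hA : IsOpen A)
    (hUV : U ∩ A = V ∩ A) : A ∩ frontier U ⊆ A ∩ frontier V := by
  rw [inter_comm U, inter_comm V] at hUV
  rintro x ⟨hxA, hx⟩
  have hUV' : A ∩ Uᶜ = A ∩ Vᶜ := by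
    ext y
    have := Set.ext_iff.1 hUV y
    simp only [mem_inter_iff, mem_compl_iff] at this ⊢
    tauto
  rw [frontier_eq_closure_inter_closure] at hx ⊢
  have key : ∀ {S T : Set X}, A ∩ S = A ∩ T → x ∈ closure S → x ∈ closure T := by
    intro S T hST hxS
    have := hA.inter_closure (t := S) ⟨hxA, hxS⟩
    rw [hST] at this
    exact closure_mono inter_subset_right this
  exact ⟨hxA, key hUV hx.1, key hUV' hx.2⟩

/-- The boundary of a set inside an open set depends only on the part of the set there. -/
theorem inter_frontier_congr {X : Type*} [TopologicalSpace X] {U V A : Set X} (hA : IsOpen A)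
    (hUV : U ∩ A = V ∩ A) : A ∩ frontier U = A ∩ frontier V :=
  (inter_frontier_subset hA hUV).antisymm (inter_frontier_subset hA hUV.symm)

theorem scalarIntegral_sub (σ τ : ScalarMeasure Ω) (ψ : 𝓓(Ω, ℝ)) :
    scalarIntegral (σ - τ) Ω ψ = scalarIntegral σ Ω ψ - scalarIntegral τ Ω ψ := by
  obtain ⟨D, hD⟩ := ψ.continuous.bounded_above_of_compact_support ψ.hasCompactSupport
  have hi : ∀ ρ : ScalarMeasure Ω, ρ.Integrable fun x : Ω => ψ x := fun ρ =>
    .of_bound (ψ.continuous.comp continuous_subtype_val).aestronglyMeasurable D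
      (.of_forall fun x => hD x)
  simp only [scalarIntegral_self]
  exact VectorMeasure.integral_sub_vectorMeasure (hi σ) (hi τ)

end Fields

end NormalTrace

end

/-! ### The main theorem -/

theorem theorem5p1 (n : ℕ) (Ω : Opens (EuclideanSpace ℝ (Fin n)))
    (F : NormalTrace.FieldMeasure Ω) (hF : NormalTrace.IsDivergenceMeasureField F)
    (U V : Set (EuclideanSpace ℝ (Fin n))) (hUm : MeasurableSet U) (hVm : MeasurableSet V)
    (hU : NormalTrace.CompactlyContained U Ω) (hV : NormalTrace.CompactlyContained V Ω)
    (A : Opens (EuclideanSpace ℝ (Fin n))) (hUV : U ∩ A = V ∩ A) :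
    (A : Set (EuclideanSpace ℝ (Fin n))) ∩ frontier U =
      (A : Set (EuclideanSpace ℝ (Fin n))) ∩ frontier V ∧
    (∀ φ : EuclideanSpace ℝ (Fin n) → ℝ, NormalTrace.MemW1InftyCompact A φ →
      NormalTrace.IsDivergenceMeasureField (NormalTrace.mulField φ F) ∧
      NormalTrace.normalTrace F U φ = NormalTrace.normalTrace F V φ) ∧
    (∀ mU mV : NormalTrace.ScalarMeasure Ω,
      NormalTrace.IsNormalTraceMeasure F U mU → NormalTrace.IsNormalTraceMeasure F V mV →
      mU.restrict ((↑) ⁻¹' (frontier U ∩ A)) = mV.restrict ((↑) ⁻¹' (frontier V ∩ A))) := by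
  have hfr := NormalTrace.inter_frontier_congr A.isOpen hUV
  refine ⟨hfr, fun φ hφ => ?_, fun mU mV hmU hmV => ?_⟩
  · have hφF := hF.mulField hφ
    refine ⟨hφF, ?_⟩
    obtain ⟨C, -, hC⟩ := hφ.exists_abs_le
    let σ := NormalTrace.divergence (NormalTrace.mulField φ F)
    have hσ : NormalTrace.HasDivergence (NormalTrace.mulField φ F) σ :=
      hφF.hasDivergence_divergence
    have hK : MeasurableSet ((↑) ⁻¹' tsupport φ : Set Ω) :=
      (isClosed_tsupport φ).measurableSet.preimage measurable_subtype_coe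
    -- `div(φF)` does not charge the complement of the support of `φ`, so only `E ∩ tsupport φ`
    -- counts.
    have hsupp : ∀ E : Set (EuclideanSpace ℝ (Fin n)), MeasurableSet E →
        σ ((↑) ⁻¹' E) = σ ((↑) ⁻¹' (E ∩ tsupport φ)) := by
      intro E hE
      have hE' : MeasurableSet ((↑) ⁻¹' E : Set Ω) := hE.preimage measurable_subtype_coe
      have h0 : σ ((↑) ⁻¹' E \ (↑) ⁻¹' tsupport φ) = 0 :=
        hσ.apply_eq_zero_of_disjoint hφ.continuous hC fun x hx => hx.2
      rw [← inter_union_sdiff ((↑) ⁻¹' E : Set Ω) ((↑) ⁻¹' tsupport φ),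
        VectorMeasure.of_union disjoint_sdiff_inter.symm (hE'.inter hK) (hE'.diff hK),
        h0, add_zero, preimage_inter]
    have hset : U ∩ tsupport φ = V ∩ tsupport φ := by
      rw [← inter_eq_right.2 hφ.2.2, ← inter_assoc, ← inter_assoc, hUV]
    change -σ _ = -σ _
    rw [hsupp U hUm, hsupp V hVm, hset]
  · rw [inter_comm, hfr, inter_comm]
    have hB : MeasurableSet ((↑) ⁻¹' (frontier V ∩ A) : Set Ω) :=
      (isClosed_frontier.measurableSet.inter A.isOpen.measurableSet).preimage
        measurable_subtype_coe
    ext S hS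
    rw [VectorMeasure.restrict_apply _ hB hS, VectorMeasure.restrict_apply _ hB hS, ← sub_eq_zero]
    change (mU - mV) _ = 0
    -- The difference of the measures vanishes on every subset of `A`, not only on boundary points;
    -- the restriction to the boundary is a special case.
    refine NormalTrace.apply_eq_zero_of_scalarIntegral_eq_zero A.isOpen (fun ψ hψ => ?_)
      fun x hx => hx.2.2
    rw [NormalTrace.scalarIntegral_sub, ← hmU ψ, ← hmV ψ,
      NormalTrace.normalTraceDistribution_congr_set F hUm hVm hUV hψ, sub_self]
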